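/- All Hilbert spaces are finite dimensional, and $\log$ is taken to any fixed base $b>1$. For a state $\rho$ let $S(\rho)=-\operatorname{tr}\rho\log\rho$. For a map $\Psi$ that takes density operators to density operators let $S_{\min}(\Psi)=\min_\rho S(\Psi(\rho))$, the minimum being over all density operators $\rho$ on the input space. Let $\Phi$ be a quantum channel (a completely positive trace preserving linear map) from operators on $\mathcal H\neq 0$ to operators on $\mathcal K$. Then $\Phi$ has a Stinespring dilation $$\Phi(X)=\operatorname{tr}_{\mathcal B}\,U\,(|0\rangle\langle 0|\otimes X)\,U^*,$$ with spaces $\mathcal A,\mathcal B$, a basis vector $|0\rangle$ of $\mathcal A$, and a unitary map $U:\mathcal A\otimes\mathcal H\to\mathcal K\otimes\mathcal B$. Given any such dilation, let $P_0=|0\rangle\langle 0|\otimes I_{\mathcal H}$ and $P_1=(I_{\mathcal A}-|0\rangle\langle 0|)\otimes I_{\mathcal H}$, and define for operators $X$ on $\mathcal A\otimes\mathcal H$ and $Y$ on $\mathcal K\otimes\mathcal B$ $$D(X)=\tfrac12 X+\tfrac12 (P_0-P_1)X(P_0-P_1),$$ $$M(X)=P_0XP_0+\operatorname{tr}(P_1XP_1)\,\frac{I_{\mathcal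 A}-|0\rangle\langle 0|}{\dim\mathcal A-1}\otimes\frac{I_{\mathcal H}}{\dim\mathcal H},$$ $$N_{\mathcal B}(Y)=(\operatorname{tr}_{\mathcal B}Y)\otimes\frac{I_{\mathcal B}}{\dim\mathcal B},\qquad \Phi'(X)=N_{\mathcal B}\bigl(U\,M(D(X))\,U^*\bigr)$$ (if $\dim\mathcal A=1$, the second term of $M$ is read as $0$). Then $\Phi'$ is random unitary, i.e. $\Phi'(X)=\sum_i p_iU_iXU_i^*$ for finitely many unitary maps $U_i:\mathcal A\otimes\mathcal H\to\mathcal K\otimes\mathcal B$ and a probability distribution $(p_i)$, and $$S_{\min}(\Phi)\;\ge\; S_{\min}(\Phi')-\log\dim\mathcal B\;\ge\; S_{\min}(\Phi)-\frac{8\log\dim\mathcal A}{\dim\mathcal A}.$$ -/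

import Mathlib

open scoped Kronecker ComplexOrder

namespace QChan

/-- Density operators on the Hilbert space `ℂ^H`: positive semidefinite, of unit trace. -/
def IsDensity {H : Type*} [Fintype H] (ρ : Matrix H H ℂ) : Prop :=
  ρ.PosSemidef ∧ ρ.trace = 1

/-- The map `id_n ⊗ Φ` on operators of `ℂ^n ⊗ ℂ^H`. -/
def ampliation {H K : Type*} (n : ℕ) (Φ : Matrix H H ℂ →ₗ[ℂ] Matrix K K ℂ)
    (X : Matrix (Fin n × H) (Fin n × H) ℂ) : Matrix (Fin n × K) (Fin n × K) ℂ :=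
  Matrix.of fun p q => Φ (Matrix.of fun x y => X (p.1, x) (q.1, y)) p.2 q.2

/-- Quantum channels: completely positive, trace preserving linear maps. -/
structure IsChannel {H K : Type*} [Fintype H] [Fintype K]
    (Φ : Matrix H H ℂ →ₗ[ℂ] Matrix K K ℂ) : Prop where
  completelyPositive : ∀ (n : ℕ) (X : Matrix (Fin n × H) (Fin n × H) ℂ),
    X.PosSemidef → (ampliation n Φ X).PosSemidef
  tracePreserving : ∀ X : Matrix H H ℂ, (Φ X).trace = X.trace

/-- `U` is a unitary map from `ℂ^I` onto `ℂ^J`. -/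
def IsUnitaryMap {I J : Type*} [Fintype I] [Fintype J] [DecidableEq I] [DecidableEq J]
    (U : Matrix J I ℂ) : Prop :=
  U.conjTranspose * U = 1 ∧ U * U.conjTranspose = 1

/-- A map is random unitary if it is a finite convex combination of unitary conjugations. -/
def IsRandomUnitary {I J : Type*} [Fintype I] [Fintype J] [DecidableEq I] [DecidableEq J]
    (Ψ : Matrix I I ℂ → Matrix J J ℂ) : Prop :=
  ∃ (n : ℕ) (p : Fin n → ℝ) (U : Fin n → Matrix J I ℂ),
    (∀ i, 0 ≤ p i) ∧ ∑ i, p i = 1 ∧ (∀ i, IsUnitaryMap (U i)) ∧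
      ∀ X, Ψ X = ∑ i, (p i : ℂ) • (U i * X * (U i).conjTranspose)

/-- The von Neumann entropy `S(ρ) = - tr ρ log ρ`, with logarithms to base `b`. The operator
`log ρ` is given by the functional calculus; as `logb b 0 = 0`, this respects `0 log 0 = 0`. -/
noncomputable def entropy (b : ℝ) {H : Type*} [Fintype H] [DecidableEq H]
    (ρ : Matrix H H ℂ) : ℝ :=
  -(ρ * cfc (Real.logb b) ρ).trace.re

/-- The minimum output entropy: the infimum of `S(Φ(ρ))` over all density operators `ρ`. -/
noncomputable def minOutputEntropy (b : ℝ) {H K : Type*} [Fintype H] [Fintype K]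
    [DecidableEq K] (Φ : Matrix H H ℂ → Matrix K K ℂ) : ℝ :=
  sInf {s | ∃ ρ : Matrix H H ℂ, IsDensity ρ ∧ s = entropy b (Φ ρ)}

/-- The partial trace over the second tensor factor. -/
def partialTrace {K B : Type*} [Fintype B] (X : Matrix (K × B) (K × B) ℂ) : Matrix K K ℂ :=
  Matrix.of fun i j => ∑ b, X (i, b) (j, b)

/-- The maximally mixed state `I / dim`. -/
noncomputable def maxMixed (H : Type*) [Fintype H] [DecidableEq H] : Matrix H H ℂ :=
  (Fintype.card H : ℂ)⁻¹ • (1 : Matrix H H ℂ)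

/-- The projector `|0⟩⟨0|` onto the basis vector of `ℂ^A` with label `a₀`. -/
def ketbra {A : Type*} [DecidableEq A] (a₀ : A) : Matrix A A ℂ :=
  Matrix.single a₀ a₀ 1

section Construction

variable {A B H K : Type*} [Fintype A] [Fintype B] [Fintype H] [Fintype K]
  [DecidableEq A] [DecidableEq B] [DecidableEq H] [DecidableEq K]

/-- `Φ(X) = tr_B U (|0⟩⟨0| ⊗ X) U*` with `U : A ⊗ H → K ⊗ B` unitary. -/
def IsStinespringDilation (Φ : Matrix H H ℂ → Matrix K K ℂ) (a₀ : A)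
    (U : Matrix (K × B) (A × H) ℂ) : Prop :=
  IsUnitaryMap U ∧ ∀ X, Φ X = partialTrace (U * (ketbra a₀ ⊗ₖ X) * U.conjTranspose)

/-- The projector onto the subspace `S₀ = |0⟩ ⊗ H`. -/
def projZero (a₀ : A) : Matrix (A × H) (A × H) ℂ :=
  ketbra a₀ ⊗ₖ (1 : Matrix H H ℂ)

/-- The projector onto the orthogonal complement of `S₀`. -/
def projPerp (a₀ : A) : Matrix (A × H) (A × H) ℂ :=
  (1 - ketbra a₀) ⊗ₖ (1 : Matrix H H ℂ)

/-- The unitary that is `1` on `S₀` and `-1` on its orthogonal complement. -/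
def phaseFlip (a₀ : A) : Matrix (A × H) (A × H) ℂ :=
  projZero a₀ - projPerp a₀

/-- The decohering operation `D`: the phase flip is applied with probability one half. -/
noncomputable def decohere (a₀ : A) (X : Matrix (A × H) (A × H) ℂ) :
    Matrix (A × H) (A × H) ℂ :=
  (1 / 2 : ℂ) • X + (1 / 2 : ℂ) • (phaseFlip a₀ * X * (phaseFlip a₀).conjTranspose)

/-- The mixing operation `M`: it leaves operators on `S₀` unchanged and replaces operators on the
orthogonal complement by a multiple of the maximally mixed state
`(I_A - |0⟩⟨0|) / (dim A - 1) ⊗ I_H / dim H` there. It is only ever applied after `decohere`, that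
is, to operators that are block diagonal with respect to `S₀` and its complement. (If `dim A = 1`
the complement is zero, and so is the second term.) -/
noncomputable def mix (a₀ : A) (X : Matrix (A × H) (A × H) ℂ) : Matrix (A × H) (A × H) ℂ :=
  projZero a₀ * X * projZero a₀ +
    (projPerp a₀ * X * projPerp a₀).trace •
      ((((Fintype.card A : ℂ) - 1)⁻¹ • (1 - ketbra a₀)) ⊗ₖ maxMixed H)

/-- The operation `N_B`, which takes the system `B` to its maximally mixed state. -/
noncomputable def mixOut (X : Matrix (K × B) (K × B) ℂ) : Matrix (K × B) (K × B) ℂ :=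
  partialTrace X ⊗ₖ maxMixed B

/-- The random unitary approximation `Φ'(X) = N_B (U [(M ∘ D)(X)] U*)` that is constructed from a
dilation `U`. -/
noncomputable def ruApprox (a₀ : A) (U : Matrix (K × B) (A × H) ℂ)
    (X : Matrix (A × H) (A × H) ℂ) : Matrix (K × B) (K × B) ℂ :=
  mixOut (U * mix a₀ (decohere a₀ X) * U.conjTranspose)

end Construction

end QChan

/-!
Block decoherence followed by mixing, and complete mixing of `B`, are averages of unitary
conjugations: sign changes kill off-diagonal entries, and permutations average the diagonal
that is left. Hence `Φ'` is random unitary.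

Decoherence has no effect before `M`, and `N_B` adds exactly `log dim B` to the entropy. On the
inputs `|0⟩⟨0| ⊗ ρ` the map `Φ'` therefore has the entropy of `Φ(ρ)` up to this constant, which is
the first inequality. On a general input, `M` outputs a convex combination of some
`|0⟩⟨0| ⊗ ρ` and of the maximally mixed state `ω` of the complement of `S₀`. With `d = dim A`, the
state `ω` is at most `d / (d - 1)` times the maximally mixed state of `A ⊗ H`, whose output is
maximally mixed, so the output of `ω` has entropy at least `log dim K - log (d / (d - 1))`.
Concavity of the entropy now bounds the loss by `log (d / (d - 1)) ≤ 8 log d / d`.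
-/

namespace QChan

open Matrix

section SpectralSums

variable {𝕜 n : Type*} [RCLike 𝕜] {A B : Matrix n n 𝕜}

theorem isHermitian_smul_add_smul (hA : A.IsHermitian) (hB : B.IsHermitian) (p q : ℝ) :
    (p • A + q • B).IsHermitian :=
  ((IsSelfAdjoint.all p).smul hA.isSelfAdjoint).add ((IsSelfAdjoint.all q).smul hB.isSelfAdjoint)

theorem isHermitian_kronecker_one {m : Type*} [DecidableEq m] (hA : A.IsHermitian) :
    (A ⊗ₖ (1 : Matrix m m 𝕜)).IsHermitian := by
  rw [Matrix.IsHermitian, conjTranspose_kronecker, hA.eq, conjTranspose_one]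

variable [Fintype n]

theorem re_dotProduct_smul_add_smul_mulVec (A B : Matrix n n 𝕜) (p q : ℝ) (x : n → 𝕜) :
    RCLike.re (star x ⬝ᵥ (p • A + q • B) *ᵥ x) =
      p • RCLike.re (star x ⬝ᵥ A *ᵥ x) + q • RCLike.re (star x ⬝ᵥ B *ᵥ x) := by
  simp only [add_mulVec, smul_mulVec, dotProduct_add, dotProduct_smul, map_add, RCLike.smul_re,
    smul_eq_mul]

variable [DecidableEq n]

theorem re_trace_cfc (hA : A.IsHermitian) (f : ℝ → ℝ) :
    RCLike.re (cfc f A).trace = ∑ i, f (hA.eigenvalues i) := by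
  rw [hA.cfc_eq, IsHermitian.cfc, Unitary.conjStarAlgAut_apply, trace_mul_cycle,
    Unitary.coe_star_mul_self, one_mul, trace_diagonal, map_sum]
  exact Finset.sum_congr rfl fun i _ => RCLike.ofReal_re _

theorem re_dotProduct_cfc_mulVec (hA : A.IsHermitian) (f : ℝ → ℝ) (x : n → 𝕜) :
    RCLike.re (star x ⬝ᵥ cfc f A *ᵥ x) =
      ∑ i, ‖(star (hA.eigenvectorUnitary : Matrix n n 𝕜) *ᵥ x) i‖ ^ 2 * f (hA.eigenvalues i) := by
  have hstar : star x ᵥ* (hA.eigenvectorUnitary : Matrix n n 𝕜) =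
      star (star (hA.eigenvectorUnitary : Matrix n n 𝕜) *ᵥ x) := by
    rw [star_mulVec, ← star_eq_conjTranspose, star_star]
  rw [hA.cfc_eq, IsHermitian.cfc, Unitary.conjStarAlgAut_apply, ← mulVec_mulVec, ← mulVec_mulVec,
    dotProduct_mulVec, hstar, dotProduct, map_sum]
  refine Finset.sum_congr rfl fun i _ => ?_
  rw [mulVec_diagonal, Pi.star_apply, mul_left_comm, RCLike.star_def, RCLike.conj_mul,
    Function.comp_apply, RCLike.re_ofReal_mul, ← RCLike.ofReal_pow, RCLike.ofReal_re, mul_comm,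
    Function.comp_apply]

theorem re_dotProduct_mulVec (hA : A.IsHermitian) (x : n → 𝕜) :
    RCLike.re (star x ⬝ᵥ A *ᵥ x) =
      ∑ i, ‖(star (hA.eigenvectorUnitary : Matrix n n 𝕜) *ᵥ x) i‖ ^ 2 * hA.eigenvalues i := by
  simpa only [cfc_id' ℝ A hA.isSelfAdjoint] using re_dotProduct_cfc_mulVec hA (fun t => t) x

theorem sum_norm_sq_star_eigenvectorUnitary_mulVec (hA : A.IsHermitian) {x : n → 𝕜}
    (hx : star x ⬝ᵥ x = 1) :
    ∑ i, ‖(star (hA.eigenvectorUnitary : Matrix n n 𝕜) *ᵥ x) i‖ ^ 2 = 1 := by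
  have h := re_dotProduct_cfc_mulVec hA (fun _ => 1) x
  rw [cfc_const_one ℝ A hA.isSelfAdjoint, one_mulVec, hx, RCLike.one_re] at h
  simpa only [mul_one] using h.symm

theorem re_dotProduct_mulVec_mem {s : Set ℝ} (hs : Convex ℝ s) (hA : A.IsHermitian)
    (hAs : ∀ i, hA.eigenvalues i ∈ s) {x : n → 𝕜} (hx : star x ⬝ᵥ x = 1) :
    RCLike.re (star x ⬝ᵥ A *ᵥ x) ∈ s := by
  rw [re_dotProduct_mulVec hA]
  exact hs.sum_mem (fun _ _ => sq_nonneg _)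
    (sum_norm_sq_star_eigenvectorUnitary_mulVec hA hx) fun i _ => hAs i

theorem re_dotProduct_cfc_mulVec_le {s : Set ℝ} {f : ℝ → ℝ}
    (hf : ConcaveOn ℝ s f) (hA : A.IsHermitian) (hAs : ∀ i, hA.eigenvalues i ∈ s) {x : n → 𝕜}
    (hx : star x ⬝ᵥ x = 1) :
    RCLike.re (star x ⬝ᵥ cfc f A *ᵥ x) ≤ f (RCLike.re (star x ⬝ᵥ A *ᵥ x)) := by
  rw [re_dotProduct_cfc_mulVec hA, re_dotProduct_mulVec hA]
  exact hf.le_map_sum (fun _ _ => sq_nonneg _)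
    (sum_norm_sq_star_eigenvectorUnitary_mulVec hA hx) fun i _ => hAs i

theorem trace_eq_sum_dotProduct_mulVec_col {W : Matrix n n 𝕜} (hW : W ∈ unitaryGroup n 𝕜)
    (X : Matrix n n 𝕜) : X.trace = ∑ i, star (W.col i) ⬝ᵥ X *ᵥ W.col i := by
  calc X.trace = (star W * X * W).trace := by
        rw [trace_mul_cycle, Unitary.mul_star_self_of_mem hW, one_mul]
    _ = _ := Finset.sum_congr rfl fun i _ => by
        rw [diag_apply, Matrix.mul_assoc, mul_apply]
        rfl

theorem star_col_dotProduct_col {W : Matrix n n 𝕜} (hW : W ∈ unitaryGroup n 𝕜) (i : n) :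
    star (W.col i) ⬝ᵥ W.col i = 1 :=
  (congrFun₂ (mem_unitaryGroup_iff'.mp hW) i i).trans (one_apply_eq i)

theorem re_dotProduct_mulVec_eigenvectorUnitary_col (hA : A.IsHermitian) (i : n) :
    RCLike.re (star ((hA.eigenvectorUnitary : Matrix n n 𝕜).col i) ⬝ᵥ
      A *ᵥ (hA.eigenvectorUnitary : Matrix n n 𝕜).col i) = hA.eigenvalues i := by
  rw [hA.eigenvalues_eq]
  rfl

theorem concaveOn_re_trace_cfc {s : Set ℝ} {f : ℝ → ℝ} (hf : ConcaveOn ℝ s f) :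
    ConcaveOn ℝ {A : Matrix n n 𝕜 | ∃ hA : A.IsHermitian, ∀ i, hA.eigenvalues i ∈ s}
      (fun A => RCLike.re (cfc f A).trace) := by
  refine ⟨fun A ⟨hA, hAs⟩ B ⟨hB, hBs⟩ p q hp hq hpq =>
      ⟨isHermitian_smul_add_smul hA hB p q, fun i => ?_⟩,
    fun A ⟨hA, hAs⟩ B ⟨hB, hBs⟩ p q hp hq hpq => ?_⟩ <;>
    have hC := isHermitian_smul_add_smul hA hB p q
  · have hx := star_col_dotProduct_col hC.eigenvectorUnitary.2 i
    rw [← re_dotProduct_mulVec_eigenvectorUnitary_col, re_dotProduct_smul_add_smul_mulVec]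
    exact hf.1 (re_dotProduct_mulVec_mem hf.1 hA hAs hx) (re_dotProduct_mulVec_mem hf.1 hB hBs hx)
      hp hq hpq
  · let w i := (hC.eigenvectorUnitary : Matrix n n 𝕜).col i
    have hw i : star (w i) ⬝ᵥ w i = 1 := star_col_dotProduct_col hC.eigenvectorUnitary.2 i
    have htrace (X : Matrix n n 𝕜) :
        RCLike.re X.trace = ∑ i, RCLike.re (star (w i) ⬝ᵥ X *ᵥ w i) := by
      rw [trace_eq_sum_dotProduct_mulVec_col hC.eigenvectorUnitary.2 X, map_sum]
    calc p • RCLike.re (cfc f A).trace + q • RCLike.re (cfc f B).trace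
        = ∑ i, (p • RCLike.re (star (w i) ⬝ᵥ cfc f A *ᵥ w i) +
            q • RCLike.re (star (w i) ⬝ᵥ cfc f B *ᵥ w i)) := by
          rw [htrace, htrace, Finset.smul_sum, Finset.smul_sum, Finset.sum_add_distrib]
      _ ≤ ∑ i, (p • f (RCLike.re (star (w i) ⬝ᵥ A *ᵥ w i)) +
            q • f (RCLike.re (star (w i) ⬝ᵥ B *ᵥ w i))) := by
          gcongr with i
          exacts [re_dotProduct_cfc_mulVec_le hf hA hAs (hw i),
            re_dotProduct_cfc_mulVec_le hf hB hBs (hw i)]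
      _ ≤ ∑ i, f (p • RCLike.re (star (w i) ⬝ᵥ A *ᵥ w i) +
            q • RCLike.re (star (w i) ⬝ᵥ B *ᵥ w i)) :=
          Finset.sum_le_sum fun i _ => hf.2 (re_dotProduct_mulVec_mem hf.1 hA hAs (hw i))
            (re_dotProduct_mulVec_mem hf.1 hB hBs (hw i)) hp hq hpq
      _ = RCLike.re (cfc f (p • A + q • B)).trace := by
          rw [re_trace_cfc hC]
          exact Finset.sum_congr rfl fun i _ => by
            rw [← re_dotProduct_smul_add_smul_mulVec, re_dotProduct_mulVec_eigenvectorUnitary_col]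

theorem cfc_kronecker_one {m : Type*} [DecidableEq m] [Fintype m] (hA : A.IsHermitian) (f : ℝ → ℝ) :
    cfc f (A ⊗ₖ (1 : Matrix m m 𝕜)) = cfc f A ⊗ₖ (1 : Matrix m m 𝕜) := by
  let φ : Matrix n n 𝕜 →⋆ₐ[𝕜] Matrix (n × m) (n × m) 𝕜 :=
    { toFun := fun X => X ⊗ₖ 1
      map_one' := one_kronecker_one
      map_mul' := fun X Y => by rw [← mul_kronecker_mul, one_mul]
      map_zero' := zero_kronecker 1
      map_add' := fun X Y => add_kronecker X Y 1
      commutes' := fun c => by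
        rw [Algebra.algebraMap_eq_smul_one, Algebra.algebraMap_eq_smul_one, smul_kronecker,
          one_kronecker_one]
      map_star' := fun X => by
        rw [star_eq_conjTranspose, star_eq_conjTranspose, conjTranspose_kronecker,
          conjTranspose_one] }
  have hφ : Continuous φ := φ.toLinearMap.continuous_of_finiteDimensional
  exact (StarAlgHomClass.map_cfc φ f A (A.finite_real_spectrum.continuousOn f) hφ
    hA.isSelfAdjoint (hA.isSelfAdjoint.map φ)).symm

end SpectralSums

section Entropy

variable {n : Type*} [Fintype n] [DecidableEq n] {A : Matrix n n ℂ}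

theorem mul_logb_eq (b x : ℝ) : x * Real.logb b x = -(Real.log b)⁻¹ * Real.negMulLog x := by
  rw [Real.logb, Real.negMulLog]
  ring

theorem entropy_eq_re_trace_cfc (b : ℝ) (hA : A.IsHermitian) :
    entropy b A = (Real.log b)⁻¹ * (cfc Real.negMulLog A).trace.re := by
  have hcont (f : ℝ → ℝ) : ContinuousOn f (spectrum ℝ A) := A.finite_real_spectrum.continuousOn f
  have hmul : A * cfc (Real.logb b) A = cfc (fun x => x * Real.logb b x) A := by
    rw [cfc_mul (fun x => x) _ A (hcont _) (hcont _), cfc_id' ℝ A hA.isSelfAdjoint]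
  rw [entropy, hmul]
  simp only [mul_logb_eq]
  rw [cfc_const_mul _ _ A (hcont _), trace_smul, Complex.smul_re, smul_eq_mul, neg_mul, neg_neg]

theorem entropy_eq_sum_eigenvalues (b : ℝ) (hA : A.IsHermitian) :
    entropy b A = (Real.log b)⁻¹ * ∑ i, Real.negMulLog (hA.eigenvalues i) := by
  rw [entropy_eq_re_trace_cfc b hA, ← RCLike.re_eq_complex_re, re_trace_cfc hA]

theorem concaveOn_entropy {b : ℝ} (hb : 1 < b) :
    ConcaveOn ℝ {A : Matrix n n ℂ | A.PosSemidef} (entropy b) := by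
  have hset : {A : Matrix n n ℂ | A.PosSemidef} =
      {A | ∃ hA : A.IsHermitian, ∀ i, hA.eigenvalues i ∈ Set.Ici 0} :=
    Set.ext fun A => ⟨fun hA => ⟨hA.isHermitian, hA.eigenvalues_nonneg⟩,
      fun ⟨hA, h⟩ => hA.posSemidef_iff_eigenvalues_nonneg.mpr h⟩
  have h := (concaveOn_re_trace_cfc (𝕜 := ℂ) (n := n) Real.concaveOn_negMulLog).smul
    (inv_nonneg.mpr (Real.log_pos hb).le)
  rw [hset]
  exact h.congr fun A ⟨hA, _⟩ => (entropy_eq_re_trace_cfc b hA).symm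

theorem entropy_smul (b : ℝ) (hA : A.IsHermitian) (c : ℝ) :
    entropy b (c • A) = c * (entropy b A - Real.logb b c * A.trace.re) := by
  have hcA : (c • A).IsHermitian := (IsSelfAdjoint.all c).smul hA.isSelfAdjoint
  have hcont (f : ℝ → ℝ) : ContinuousOn f (spectrum ℝ A) := A.finite_real_spectrum.continuousOn f
  have hscale (x : ℝ) :
      Real.negMulLog (c • x) = c * Real.negMulLog x + -(c * Real.log c) * x := by
    rw [smul_eq_mul, Real.negMulLog_mul, Real.negMulLog]
    ring
  rw [entropy_eq_re_trace_cfc b hcA, ← cfc_comp_smul c _ A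
    ((A.finite_real_spectrum.image _).continuousOn _) hA.isSelfAdjoint]
  simp only [hscale]
  rw [cfc_add A (fun x => c * x.negMulLog) (fun x => -(c * Real.log c) * x) (hcont _) (hcont _),
    cfc_const_mul _ _ A (hcont _),
    cfc_const_mul_id _ A hA.isSelfAdjoint, trace_add, trace_smul, trace_smul, Complex.add_re,
    Complex.smul_re, Complex.smul_re, entropy_eq_re_trace_cfc b hA, Real.logb]
  simp only [smul_eq_mul]
  ring

variable {m : Type*} [Fintype m] [DecidableEq m]

theorem entropy_kronecker_one (b : ℝ) (hA : A.IsHermitian) :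
    entropy b (A ⊗ₖ (1 : Matrix m m ℂ)) = Fintype.card m * entropy b A := by
  rw [entropy_eq_re_trace_cfc b (isHermitian_kronecker_one hA), cfc_kronecker_one hA,
    trace_kronecker, trace_one, entropy_eq_re_trace_cfc b hA, mul_comm (trace _), ← nsmul_eq_mul,
    Complex.re_nsmul, nsmul_eq_mul]
  ring

variable (m) in
theorem maxMixed_eq_inv_smul_one :
    maxMixed m = (Fintype.card m : ℝ)⁻¹ • (1 : Matrix m m ℂ) := by
  rw [maxMixed, ← Complex.ofReal_natCast, ← Complex.ofReal_inv, Complex.coe_smul]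

namespace IsDensity

variable {ρ : Matrix n n ℂ}

theorem sum_eigenvalues (hρ : IsDensity ρ) : ∑ i, hρ.1.isHermitian.eigenvalues i = 1 := by
  have h := hρ.1.isHermitian.trace_eq_sum_eigenvalues
  exact Complex.ofReal_injective (by simpa [hρ.2] using h.symm)

theorem eigenvalues_le_one (hρ : IsDensity ρ) (i : n) : hρ.1.isHermitian.eigenvalues i ≤ 1 :=
  hρ.sum_eigenvalues ▸
    Finset.single_le_sum (fun j _ => hρ.1.eigenvalues_nonneg j) (Finset.mem_univ i)

omit [DecidableEq n] in
theorem nonempty (hρ : IsDensity ρ) : Nonempty n := by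
  by_contra h
  have := not_nonempty_iff.mp h
  simpa only [trace, Finset.univ_eq_empty, Finset.sum_empty, zero_ne_one] using hρ.2

theorem entropy_nonneg {b : ℝ} (hb : 1 < b) (hρ : IsDensity ρ) : 0 ≤ entropy b ρ := by
  rw [entropy_eq_sum_eigenvalues b hρ.1.isHermitian]
  exact mul_nonneg (inv_nonneg.mpr (Real.log_pos hb).le) (Finset.sum_nonneg fun i _ =>
    Real.negMulLog_nonneg (hρ.1.eigenvalues_nonneg i) (hρ.eigenvalues_le_one i))

theorem entropy_le_logb_card {b : ℝ} (hb : 1 < b) (hρ : IsDensity ρ) :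
    entropy b ρ ≤ Real.logb b (Fintype.card n) := by
  have := hρ.nonempty
  have hd : (0 : ℝ) < Fintype.card n := by exact_mod_cast Fintype.card_pos
  have hJensen := Real.concaveOn_negMulLog.le_map_sum (t := Finset.univ)
    (w := fun _ : n => (Fintype.card n : ℝ)⁻¹) (p := hρ.1.isHermitian.eigenvalues)
    (fun _ _ => by positivity) (by simp [hd.ne']) (fun i _ => hρ.1.eigenvalues_nonneg i)
  simp only [smul_eq_mul, ← Finset.mul_sum, hρ.sum_eigenvalues, mul_one] at hJensen
  rw [Real.negMulLog, Real.log_inv, neg_mul_neg] at hJensen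
  rw [entropy_eq_sum_eigenvalues b hρ.1.isHermitian, Real.logb, div_eq_inv_mul]
  exact mul_le_mul_of_nonneg_left (le_of_mul_le_mul_left hJensen (inv_pos.mpr hd))
    (inv_nonneg.mpr (Real.log_pos hb).le)

theorem neg_logb_le_entropy {b c : ℝ} (hb : 1 < b) (hρ : IsDensity ρ)
    (hc : (c • (1 : Matrix n n ℂ) - ρ).PosSemidef) : -Real.logb b c ≤ entropy b ρ := by
  have hle i : hρ.1.isHermitian.eigenvalues i ≤ c := by
    have hx := star_col_dotProduct_col hρ.1.isHermitian.eigenvectorUnitary.2 i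
    have h := (Complex.le_def.mp (hc.dotProduct_mulVec_nonneg
      ((hρ.1.isHermitian.eigenvectorUnitary : Matrix n n ℂ).col i))).1
    rw [sub_mulVec, smul_mulVec, one_mulVec, dotProduct_sub, dotProduct_smul, hx,
      Complex.sub_re, ← RCLike.re_eq_complex_re,
      re_dotProduct_mulVec_eigenvectorUnitary_col] at h
    simpa using h
  have hterm (x : ℝ) (hx : 0 ≤ x) (hxc : x ≤ c) : x * -Real.log c ≤ Real.negMulLog x := by
    rcases hx.eq_or_lt with rfl | hx
    · simp
    · rw [Real.negMulLog, neg_mul_comm]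
      gcongr
  rw [entropy_eq_sum_eigenvalues b hρ.1.isHermitian, Real.logb, div_eq_inv_mul, ← mul_neg]
  refine mul_le_mul_of_nonneg_left ?_ (inv_nonneg.mpr (Real.log_pos hb).le)
  calc -Real.log c = ∑ i, hρ.1.isHermitian.eigenvalues i * -Real.log c := by
        rw [← Finset.sum_mul, hρ.sum_eigenvalues, one_mul]
    _ ≤ _ := Finset.sum_le_sum fun i _ => hterm _ (hρ.1.eigenvalues_nonneg i) (hle i)

theorem entropy_kronecker_maxMixed [Nonempty m] (b : ℝ) (hρ : IsDensity ρ) :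
    entropy b (ρ ⊗ₖ maxMixed m) = entropy b ρ + Real.logb b (Fintype.card m) := by
  have hd : (Fintype.card m : ℝ) ≠ 0 := Nat.cast_ne_zero.mpr Fintype.card_ne_zero
  have hmixed : ρ ⊗ₖ maxMixed m = (Fintype.card m : ℝ)⁻¹ • (ρ ⊗ₖ (1 : Matrix m m ℂ)) := by
    rw [maxMixed_eq_inv_smul_one, kronecker_smul]
  have htrace : (ρ ⊗ₖ (1 : Matrix m m ℂ)).trace.re = (Fintype.card m : ℝ) := by
    rw [trace_kronecker, hρ.2, one_mul, trace_one, Complex.natCast_re]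
  rw [hmixed, entropy_smul b (isHermitian_kronecker_one hρ.1.isHermitian), htrace,
    entropy_kronecker_one b hρ.1.isHermitian, Real.logb_inv]
  field_simp
  ring

end IsDensity

end Entropy

section RandomUnitary

variable {I J L : Type*} [Fintype I] [Fintype J] [Fintype L] [DecidableEq I] [DecidableEq J]
  [DecidableEq L]

theorem IsUnitaryMap.mul {U : Matrix J I ℂ} {V : Matrix L J ℂ} (hV : IsUnitaryMap V)
    (hU : IsUnitaryMap U) : IsUnitaryMap (V * U) := by
  constructor
  · rw [conjTranspose_mul, Matrix.mul_assoc, ← Matrix.mul_assoc Vᴴ, hV.1, Matrix.one_mul, hU.1]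
  · rw [conjTranspose_mul, Matrix.mul_assoc, ← Matrix.mul_assoc U, hU.2, Matrix.one_mul, hV.2]

theorem IsUnitaryMap.isRandomUnitary {U : Matrix J I ℂ} (hU : IsUnitaryMap U) :
    IsRandomUnitary fun X : Matrix I I ℂ => U * X * Uᴴ :=
  ⟨1, fun _ => 1, fun _ => U, fun _ => zero_le_one, by simp, fun _ => hU, fun X => by simp⟩

theorem IsRandomUnitary.congr {Ψ Θ : Matrix I I ℂ → Matrix J J ℂ} (hΨ : IsRandomUnitary Ψ)
    (h : ∀ X, Θ X = Ψ X) : IsRandomUnitary Θ :=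
  funext h ▸ hΨ

theorem IsRandomUnitary.convex_sum {ι : Type*} [Fintype ι] {p : ι → ℝ}
    {Ψ : ι → Matrix I I ℂ → Matrix J J ℂ} (hΨ : ∀ i, IsRandomUnitary (Ψ i)) (hp : ∀ i, 0 ≤ p i)
    (hp1 : ∑ i, p i = 1) : IsRandomUnitary fun X => ∑ i, (p i : ℂ) • Ψ i X := by
  choose n q U hq hq1 hU hΨU using hΨ
  let e := (Fintype.equivFin (Σ i, Fin (n i))).symm
  refine ⟨_, fun k => p (e k).1 * q _ (e k).2, fun k => U _ (e k).2,
    fun k => mul_nonneg (hp _) (hq _ _), ?_, fun k => hU _ _, fun X => ?_⟩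
  · calc _ = ∑ x : Σ i, Fin (n i), p x.1 * q x.1 x.2 :=
          e.sum_comp fun x : Σ i, Fin (n i) => p x.1 * q x.1 x.2
      _ = 1 := by simp only [Fintype.sum_sigma, ← Finset.mul_sum, hq1, mul_one, hp1]
  · calc ∑ i, (p i : ℂ) • Ψ i X
        = ∑ x : Σ i, Fin (n i), ((p x.1 * q x.1 x.2 : ℝ) : ℂ) •
            (U x.1 x.2 * X * (U x.1 x.2)ᴴ) := by
          simp only [Fintype.sum_sigma, hΨU, Finset.smul_sum, smul_smul, Complex.ofReal_mul]
      _ = _ := (e.sum_comp fun x : Σ i, Fin (n i) => ((p x.1 * q x.1 x.2 : ℝ) : ℂ) •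
            (U x.1 x.2 * X * (U x.1 x.2)ᴴ)).symm

theorem IsRandomUnitary.average {ι : Type*} [Fintype ι] [Nonempty ι]
    {Ψ : ι → Matrix I I ℂ → Matrix J J ℂ} (hΨ : ∀ i, IsRandomUnitary (Ψ i)) :
    IsRandomUnitary fun X => (Fintype.card ι : ℂ)⁻¹ • ∑ i, Ψ i X := by
  have h := convex_sum hΨ (p := fun _ => (Fintype.card ι : ℝ)⁻¹)
    (fun _ => by positivity) (by simp)
  simpa only [← Finset.smul_sum, Complex.ofReal_inv, Complex.ofReal_natCast] using h

theorem IsRandomUnitary.comp {Θ : Matrix J J ℂ → Matrix L L ℂ} {Ψ : Matrix I I ℂ → Matrix J J ℂ}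
    (hΘ : IsRandomUnitary Θ) (hΨ : IsRandomUnitary Ψ) : IsRandomUnitary fun X => Θ (Ψ X) := by
  obtain ⟨k, p, U, hp, hp1, hU, hΨU⟩ := hΨ
  obtain ⟨l, q, V, hq, hq1, hV, hΘV⟩ := hΘ
  refine (convex_sum (fun j => convex_sum
    (fun i => ((hV j).mul (hU i)).isRandomUnitary) hp hp1) hq hq1).congr fun X => ?_
  simp only [hΘV, hΨU, Matrix.mul_sum, Matrix.sum_mul, Matrix.mul_smul, Matrix.smul_mul,
    conjTranspose_mul, Matrix.mul_assoc]

theorem isRandomUnitary_submatrix (e : J ≃ I) :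
    IsRandomUnitary fun X : Matrix I I ℂ => X.submatrix e e := by
  let P : Matrix J I ℂ := (1 : Matrix I I ℂ).submatrix e (Equiv.refl I)
  have hPstar : Pᴴ = (1 : Matrix I I ℂ).submatrix (Equiv.refl I) e := by
    rw [conjTranspose_submatrix, conjTranspose_one]
  have hP : IsUnitaryMap P := by
    constructor <;> rw [hPstar, submatrix_mul_equiv, one_mul, submatrix_one_equiv]
  refine hP.isRandomUnitary.congr fun X => ?_
  calc X.submatrix e e = P * X.submatrix (Equiv.refl I) (Equiv.refl I) * Pᴴ := by
        rw [hPstar, submatrix_mul_equiv, submatrix_mul_equiv, one_mul, mul_one]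
    _ = P * X * Pᴴ := by rw [Equiv.coe_refl, submatrix_id_id]

theorem intCast_units_mul_self (ε : ℤˣ) : ((ε : ℤ) : ℂ) * ((ε : ℤ) : ℂ) = 1 := by
  rw [← Int.cast_mul, ← Units.val_mul, Int.units_mul_self, Units.val_one, Int.cast_one]

theorem sum_sign_mul_sign (x y : I) :
    ∑ ε : I → ℤˣ, ((ε x : ℤ) : ℂ) * ((ε y : ℤ) : ℂ) =
      if x = y then (Fintype.card (I → ℤˣ) : ℂ) else 0 := by
  split_ifs with hxy
  · subst hxy
    simp only [intCast_units_mul_self, Finset.sum_const, Finset.card_univ, nsmul_eq_mul, mul_one]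
  · have hflip := Equiv.sum_comp (Equiv.mulRight (Pi.mulSingle x (-1) : I → ℤˣ))
      fun ε : I → ℤˣ => ((ε x : ℤ) : ℂ) * ((ε y : ℤ) : ℂ)
    simp only [Equiv.coe_mulRight, Pi.mul_apply, Pi.mulSingle_eq_same, mul_neg, mul_one,
      Pi.mulSingle_eq_of_ne (Ne.symm hxy), Units.val_neg, Int.cast_neg, neg_mul,
      Finset.sum_neg_distrib] at hflip
    exact self_eq_neg.mp hflip.symm

theorem isRandomUnitary_diagonal_diag :
    IsRandomUnitary fun X : Matrix I I ℂ => diagonal X.diag := by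
  let D (ε : I → ℤˣ) : Matrix I I ℂ := diagonal fun i => ((ε i : ℤ) : ℂ)
  have hDstar (ε : I → ℤˣ) : (D ε)ᴴ = D ε := by
    rw [diagonal_conjTranspose]
    exact congrArg diagonal (funext fun i => map_intCast (starRingEnd ℂ) _)
  have hD (ε : I → ℤˣ) : IsUnitaryMap (D ε) := by
    have h : D ε * D ε = 1 := by
      rw [diagonal_mul_diagonal, ← diagonal_one]
      exact congrArg diagonal (funext fun i => intCast_units_mul_self (ε i))
    rw [IsUnitaryMap, hDstar, and_self, h]
  refine (IsRandomUnitary.average fun ε => (hD ε).isRandomUnitary).congr fun X => ?_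
  ext i j
  calc diagonal X.diag i j
      = (Fintype.card (I → ℤˣ) : ℂ)⁻¹ *
          ((∑ ε : I → ℤˣ, ((ε i : ℤ) : ℂ) * ((ε j : ℤ) : ℂ)) * X i j) := by
        rw [sum_sign_mul_sign, diagonal_apply]
        split_ifs with h
        · rw [inv_mul_cancel_left₀ (Nat.cast_ne_zero.mpr Fintype.card_ne_zero), h, diag_apply]
        · rw [zero_mul, mul_zero]
    _ = _ := by
        rw [Matrix.smul_apply, Matrix.sum_apply, smul_eq_mul, Finset.sum_mul]
        simp only [hDstar, D, mul_diagonal, diagonal_mul, mul_right_comm]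

theorem sum_perm_apply (f : I → ℂ) (x : I) :
    ∑ σ : Equiv.Perm I, f (σ x) =
      Fintype.card (Equiv.Perm I) * ((Fintype.card I : ℂ)⁻¹ * ∑ z, f z) := by
  have hconst (y : I) : ∑ σ : Equiv.Perm I, f (σ y) = ∑ σ : Equiv.Perm I, f (σ x) := by
    simpa using Equiv.sum_comp (Equiv.mulRight (Equiv.swap x y)) fun σ : Equiv.Perm I => f (σ x)
  have : Nonempty I := ⟨x⟩
  have hcard : (Fintype.card I : ℂ) ≠ 0 := Nat.cast_ne_zero.mpr Fintype.card_ne_zero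
  have hsum : Fintype.card I * ∑ σ : Equiv.Perm I, f (σ x) =
      Fintype.card (Equiv.Perm I) * ∑ z, f z := by
    calc _ = ∑ y, ∑ σ : Equiv.Perm I, f (σ y) := by simp [hconst]
      _ = _ := by rw [Finset.sum_comm]; simp [fun σ : Equiv.Perm I => Equiv.sum_comp σ f]
  rw [mul_left_comm, ← hsum, inv_mul_cancel_left₀ hcard]

theorem isRandomUnitary_trace_smul_maxMixed :
    IsRandomUnitary fun X : Matrix I I ℂ => X.trace • maxMixed I := by
  refine (IsRandomUnitary.average fun σ : Equiv.Perm I =>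
    (isRandomUnitary_submatrix σ).comp isRandomUnitary_diagonal_diag).congr fun X => ?_
  have hsubmatrix (σ : Equiv.Perm I) :
      (diagonal X.diag).submatrix σ σ = diagonal fun i => X (σ i) (σ i) :=
    submatrix_diagonal_equiv X.diag σ
  have hcard : (Fintype.card (Equiv.Perm I) : ℂ) ≠ 0 := Nat.cast_ne_zero.mpr Fintype.card_ne_zero
  ext i j
  simp only [hsubmatrix, maxMixed, Matrix.smul_apply, Matrix.sum_apply, diagonal_apply,
    one_apply, smul_eq_mul]
  split_ifs with h
  · rw [sum_perm_apply (fun z => X z z), inv_mul_cancel_left₀ hcard, mul_one, mul_comm]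
    rfl
  · simp only [mul_zero, Finset.sum_const_zero]

theorem IsUnitaryMap.fromBlocks {M : Type*} [Fintype M] [DecidableEq M] {U : Matrix J I ℂ}
    {V : Matrix M L ℂ} (hU : IsUnitaryMap U) (hV : IsUnitaryMap V) :
    IsUnitaryMap (Matrix.fromBlocks U 0 0 V) := by
  constructor <;>
    simp only [fromBlocks_conjTranspose, conjTranspose_zero, fromBlocks_multiply, Matrix.mul_zero,
      Matrix.zero_mul, add_zero, zero_add, hU.1, hU.2, hV.1, hV.2, fromBlocks_one]

theorem isRandomUnitary_blockDiagonal :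
    IsRandomUnitary fun X : Matrix (I ⊕ J) (I ⊕ J) ℂ =>
      fromBlocks X.toBlocks₁₁ 0 0 X.toBlocks₂₂ := by
  let V (ε : ℤˣ) : Matrix (I ⊕ J) (I ⊕ J) ℂ := fromBlocks 1 0 0 (((ε : ℤ) : ℂ) • 1)
  have hVstar (ε : ℤˣ) : (V ε)ᴴ = V ε := by
    rw [fromBlocks_conjTranspose, conjTranspose_one, conjTranspose_zero, conjTranspose_zero,
      conjTranspose_smul, star_intCast, conjTranspose_one]
  have hV (ε : ℤˣ) : IsUnitaryMap (V ε) := by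
    refine IsUnitaryMap.fromBlocks ⟨by simp, by simp⟩ ⟨?_, ?_⟩ <;>
      rw [conjTranspose_smul, star_intCast, conjTranspose_one, smul_mul_smul_comm, one_mul,
        intCast_units_mul_self, one_smul]
  have hconj (ε : ℤˣ) (X : Matrix (I ⊕ J) (I ⊕ J) ℂ) : V ε * X * (V ε)ᴴ =
      fromBlocks X.toBlocks₁₁ (((ε : ℤ) : ℂ) • X.toBlocks₁₂) (((ε : ℤ) : ℂ) • X.toBlocks₂₁)
        X.toBlocks₂₂ := by
    conv_lhs => rw [← fromBlocks_toBlocks X]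
    simp only [hVstar, V, fromBlocks_multiply, Matrix.mul_zero, Matrix.zero_mul, add_zero,
      zero_add, Matrix.one_mul, Matrix.mul_one, Matrix.smul_mul, Matrix.mul_smul, smul_smul,
      intCast_units_mul_self, one_smul]
  refine (IsRandomUnitary.average fun ε => (hV ε).isRandomUnitary).congr fun X => ?_
  rw [UnitsInt.univ, Finset.sum_pair (by decide), hconj, hconj, fromBlocks_add, fromBlocks_smul,
    Fintype.card_units_int]
  simp only [Units.val_one, Units.val_neg, Int.cast_one, Int.cast_neg, neg_smul, one_smul,
    add_neg_cancel, smul_zero, ← two_smul ℂ, Nat.cast_ofNat, smul_smul,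
    inv_mul_cancel₀ (two_ne_zero : (2 : ℂ) ≠ 0)]

theorem IsRandomUnitary.fromBlocks {Ψ : Matrix J J ℂ → Matrix L L ℂ} (hΨ : IsRandomUnitary Ψ) :
    IsRandomUnitary fun X : Matrix (I ⊕ J) (I ⊕ J) ℂ =>
      fromBlocks X.toBlocks₁₁ 0 0 (Ψ X.toBlocks₂₂) := by
  obtain ⟨k, p, U, hp, hp1, hU, hΨU⟩ := hΨ
  have hone : IsUnitaryMap (1 : Matrix I I ℂ) := ⟨by simp, by simp⟩
  refine ((IsRandomUnitary.convex_sum (fun i => (hone.fromBlocks (hU i)).isRandomUnitary) hp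
    hp1).comp isRandomUnitary_blockDiagonal).congr fun X => ?_
  simp only [fromBlocks_conjTranspose, fromBlocks_multiply, hΨU]
  ext (x | x) (y | y)
  · simp [Matrix.sum_apply, ← Finset.sum_mul, ← Complex.ofReal_sum, hp1]
  all_goals simp [Matrix.sum_apply]

theorem IsRandomUnitary.tensor {Ψ : Matrix J J ℂ → Matrix L L ℂ} (hΨ : IsRandomUnitary Ψ) :
    IsRandomUnitary fun X : Matrix (I × J) (I × J) ℂ =>
      of fun x y : I × L => Ψ (X.submatrix (Prod.mk x.1) (Prod.mk y.1)) x.2 y.2 := by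
  obtain ⟨k, p, U, hp, hp1, hU, hΨU⟩ := hΨ
  have hV i : IsUnitaryMap ((1 : Matrix I I ℂ) ⊗ₖ U i) := by
    constructor <;> rw [conjTranspose_kronecker, ← mul_kronecker_mul, conjTranspose_one, one_mul]
    exacts [by rw [(hU i).1, one_kronecker_one], by rw [(hU i).2, one_kronecker_one]]
  refine (IsRandomUnitary.convex_sum (fun i => (hV i).isRandomUnitary) hp hp1).congr fun X => ?_
  ext x y
  rw [of_apply, hΨU, Matrix.sum_apply, Matrix.sum_apply]
  refine Finset.sum_congr rfl fun i _ => ?_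
  simp only [Matrix.smul_apply]
  congr 1
  simp [mul_apply, Fintype.sum_prod_type, one_apply, conjTranspose_kronecker]

end RandomUnitary

section Mixing

variable {A B H K : Type*} [DecidableEq A] [DecidableEq H]

theorem projZero_eq_diagonal (a₀ : A) :
    projZero a₀ = diagonal fun x : A × H => if x.1 = a₀ then (1 : ℂ) else 0 := by
  rw [projZero, ketbra, ← diagonal_single, ← diagonal_one, diagonal_kronecker_diagonal]
  simp only [mul_one, Pi.single_apply]

theorem projPerp_eq_diagonal (a₀ : A) :
    projPerp a₀ = diagonal fun x : A × H => if x.1 = a₀ then (0 : ℂ) else 1 := by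
  rw [projPerp, ketbra, ← diagonal_single, ← diagonal_one, diagonal_sub, ← diagonal_one,
    diagonal_kronecker_diagonal]
  refine congrArg diagonal (funext fun x => ?_)
  rw [mul_one, Pi.single_apply]
  split_ifs <;> simp

theorem phaseFlip_eq_diagonal (a₀ : A) :
    phaseFlip a₀ = diagonal fun x : A × H => if x.1 = a₀ then (1 : ℂ) else -1 := by
  rw [phaseFlip, projZero_eq_diagonal, projPerp_eq_diagonal, diagonal_sub]
  refine congrArg diagonal (funext fun x => ?_)
  split_ifs <;> simp

variable [Fintype A] [Fintype H]

/-- The maximally mixed state `(I_A - |0⟩⟨0|) / (dim A - 1) ⊗ I_H / dim H` on the orthogonal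
complement of `S₀`, with which `mix` replaces the operators there. It is zero if `dim A = 1`. -/
noncomputable def perpMixed (a₀ : A) : Matrix (A × H) (A × H) ℂ :=
  (((Fintype.card A : ℂ) - 1)⁻¹ • (1 - ketbra a₀)) ⊗ₖ maxMixed H

omit [DecidableEq H] in
theorem card_fst_ne (a₀ : A) :
    (Fintype.card {x : A × H // ¬x.1 = a₀} : ℂ) = (Fintype.card A - 1) * Fintype.card H := by
  have : Nonempty A := ⟨a₀⟩
  rw [Fintype.card_congr (Equiv.prodSubtypeFstEquivSubtypeProd (p := fun a => ¬a = a₀)),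
    Fintype.card_prod, Fintype.card_subtype_compl, Fintype.card_subtype_eq, Nat.cast_mul,
    Nat.cast_pred Fintype.card_pos]

theorem perpMixed_eq_smul_projPerp (a₀ : A) :
    perpMixed a₀ =
      (Fintype.card {x : A × H // ¬x.1 = a₀} : ℂ)⁻¹ • (projPerp a₀ : Matrix (A × H) _ ℂ) := by
  rw [perpMixed, maxMixed, smul_kronecker, kronecker_smul, smul_smul, card_fst_ne, mul_inv,
    projPerp]

theorem mix_submatrix_sumCompl (a₀ : A) (X : Matrix (A × H) (A × H) ℂ) :
    let e := Equiv.sumCompl fun x : A × H => x.1 = a₀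
    (mix a₀ X).submatrix e e = fromBlocks (X.submatrix e e).toBlocks₁₁ 0 0
      ((X.submatrix e e).toBlocks₂₂.trace • maxMixed {x : A × H // ¬x.1 = a₀}) := by
  intro e
  have htrace : (projPerp a₀ * X * projPerp a₀).trace = (X.submatrix e e).toBlocks₂₂.trace := by
    rw [projPerp_eq_diagonal, trace, ← e.sum_comp, Fintype.sum_sum_type]
    simp only [diag_apply, mul_diagonal, diagonal_mul]
    have hinl (x : {x : A × H // x.1 = a₀}) : (e (Sum.inl x)).1 = a₀ := x.2
    have hinr (x : {x : A × H // ¬x.1 = a₀}) : ¬(e (Sum.inr x)).1 = a₀ := x.2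
    simp only [hinl, hinr, if_true, if_false, mul_zero, Finset.sum_const_zero, zero_add, one_mul,
      mul_one]
    rfl
  rw [mix, ← perpMixed, htrace, perpMixed_eq_smul_projPerp, projZero_eq_diagonal,
    projPerp_eq_diagonal]
  generalize (X.submatrix e e).toBlocks₂₂.trace = t
  ext (x | x) (y | y)
  · simp [e, x.2, y.2, toBlocks₁₁, diagonal_apply]
  · simp [e, x.2, y.2, toBlocks₁₁, diagonal_apply]
  · have hxy : (x : A × H) ≠ y := fun h => x.2 (h ▸ y.2)
    simp [e, x.2, y.2, toBlocks₁₁, hxy]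
  · simp [e, x.2, y.2, maxMixed, diagonal_apply, one_apply, Subtype.ext_iff]

theorem isRandomUnitary_mix (a₀ : A) :
    IsRandomUnitary (mix a₀ : Matrix (A × H) (A × H) ℂ → _) := by
  let e := Equiv.sumCompl fun x : A × H => x.1 = a₀
  refine ((isRandomUnitary_submatrix e.symm).comp
    (isRandomUnitary_trace_smul_maxMixed.fromBlocks.comp (isRandomUnitary_submatrix e))).congr
    fun X => ?_
  rw [← mix_submatrix_sumCompl, submatrix_submatrix, Equiv.self_comp_symm, submatrix_id_id]

theorem mix_decohere (a₀ : A) (X : Matrix (A × H) (A × H) ℂ) :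
    mix a₀ (decohere a₀ X) = mix a₀ X := by
  have hsandwich {f : A × H → ℂ} {c : ℂ} (hc : c * c = 1)
      (hf : ∀ x, f x * (if x.1 = a₀ then 1 else -1) = c * f x) :
      diagonal f * decohere a₀ X * diagonal f = diagonal f * X * diagonal f := by
    ext x y
    have hstar (z : A × H) :
        star (if z.1 = a₀ then (1 : ℂ) else -1) = if z.1 = a₀ then 1 else -1 := by
      split_ifs <;> simp only [star_neg, star_one]
    simp only [decohere, phaseFlip_eq_diagonal, diagonal_conjTranspose, mul_diagonal, diagonal_mul,
      Matrix.add_apply, Matrix.smul_apply, smul_eq_mul, Pi.star_apply, hstar]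
    linear_combination (1 / 2 * X x y) *
      ((if y.1 = a₀ then (1 : ℂ) else -1) * f y * hf x + c * f x * hf y + f x * f y * hc)
  have hzero := hsandwich (f := fun x => if x.1 = a₀ then 1 else 0) (one_mul 1)
    fun x => by split_ifs <;> simp
  have hperp := hsandwich (f := fun x => if x.1 = a₀ then 0 else 1) (c := -1) (by norm_num)
    fun x => by split_ifs <;> simp
  rw [← projZero_eq_diagonal] at hzero
  rw [← projPerp_eq_diagonal] at hperp
  rw [mix, hzero, hperp, mix]

variable [Fintype B] [DecidableEq B]

theorem ruApprox_eq_mixOut_mix (a₀ : A) (U : Matrix (K × B) (A × H) ℂ)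
    (X : Matrix (A × H) (A × H) ℂ) : ruApprox a₀ U X = mixOut (U * mix a₀ X * Uᴴ) := by
  rw [ruApprox, mix_decohere]

variable [Fintype K] [DecidableEq K]

theorem isRandomUnitary_mixOut : IsRandomUnitary (mixOut : Matrix (K × B) (K × B) ℂ → _) :=
  isRandomUnitary_trace_smul_maxMixed.tensor.congr fun _ => rfl

theorem isRandomUnitary_ruApprox (a₀ : A) {U : Matrix (K × B) (A × H) ℂ} (hU : IsUnitaryMap U) :
    IsRandomUnitary (ruApprox a₀ U) :=
  (isRandomUnitary_mixOut.comp (hU.isRandomUnitary.comp (isRandomUnitary_mix a₀))).congr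
    (ruApprox_eq_mixOut_mix a₀ U)

end Mixing

section DensityOperators

variable {n m : Type*} [Fintype n] [Fintype m] {ρ : Matrix n n ℂ}

theorem IsDensity.kronecker {τ : Matrix m m ℂ} (hρ : IsDensity ρ) (hτ : IsDensity τ) :
    IsDensity (ρ ⊗ₖ τ) :=
  ⟨hρ.1.kronecker hτ.1, by rw [trace_kronecker, hρ.2, hτ.2, one_mul]⟩

theorem IsDensity.mul_mul_conjTranspose [DecidableEq n] (hρ : IsDensity ρ) {V : Matrix m n ℂ}
    (hV : Vᴴ * V = 1) : IsDensity (V * ρ * Vᴴ) :=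
  ⟨hρ.1.mul_mul_conjTranspose_same V, by rw [trace_mul_cycle, hV, one_mul, hρ.2]⟩

omit [Fintype n] in
theorem posSemidef_partialTrace {X : Matrix (n × m) (n × m) ℂ} (hX : X.PosSemidef) :
    (partialTrace X).PosSemidef := by
  have hsum : partialTrace X = ∑ i, X.submatrix (fun k => (k, i)) (fun k => (k, i)) := by
    ext k l
    rw [Matrix.sum_apply]
    rfl
  exact hsum ▸ posSemidef_sum _ fun i _ => hX.submatrix _

theorem trace_partialTrace (X : Matrix (n × m) (n × m) ℂ) : (partialTrace X).trace = X.trace := by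
  rw [trace, trace, Fintype.sum_prod_type]
  rfl

variable [DecidableEq n] [DecidableEq m]

theorem isDensity_ketbra (a₀ : n) : IsDensity (ketbra a₀) := by
  refine ⟨?_, trace_single_eq_same _ _⟩
  rw [ketbra, ← diagonal_single]
  exact PosSemidef.diagonal (Pi.single_nonneg.mpr zero_le_one)

theorem isDensity_maxMixed [Nonempty n] : IsDensity (maxMixed n) := by
  have hcard : (Fintype.card n : ℝ) ≠ 0 := Nat.cast_ne_zero.mpr Fintype.card_ne_zero
  rw [maxMixed_eq_inv_smul_one]
  refine ⟨PosSemidef.one.smul (by positivity), ?_⟩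
  rw [trace_smul, trace_one, ← Complex.ofReal_natCast, Complex.real_smul, ← Complex.ofReal_mul,
    inv_mul_cancel₀ hcard, Complex.ofReal_one]

omit [DecidableEq n] in
theorem exists_isDensity_eq_smul [Nonempty n] {A : Matrix n n ℂ} (hA : A.PosSemidef) :
    ∃ ρ, IsDensity ρ ∧ ∃ p : ℝ, 0 ≤ p ∧ A = p • ρ := by
  classical
  obtain ⟨p, hp, htrace⟩ := RCLike.nonneg_iff_exists_ofReal.mp hA.trace_nonneg
  rcases hp.eq_or_lt with rfl | hpos
  · refine ⟨maxMixed n, isDensity_maxMixed, 0, le_rfl, ?_⟩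
    rw [zero_smul, ← hA.trace_eq_zero_iff, ← htrace, RCLike.ofReal_zero]
  · refine ⟨p⁻¹ • A, ⟨hA.smul (inv_nonneg.mpr hp), ?_⟩, p, hp, (smul_inv_smul₀ hpos.ne' A).symm⟩
    rw [trace_smul, ← htrace, RCLike.ofReal_eq_complex_ofReal, Complex.real_smul,
      ← Complex.ofReal_mul, inv_mul_cancel₀ hpos.ne', Complex.ofReal_one]

theorem IsRandomUnitary.isDensity_apply {Ψ : Matrix n n ℂ → Matrix m m ℂ}
    (hΨ : IsRandomUnitary Ψ) (hρ : IsDensity ρ) : IsDensity (Ψ ρ) := by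
  obtain ⟨k, p, V, hp, hp1, hV, hΨV⟩ := hΨ
  have hVρ i : IsDensity (V i * ρ * (V i)ᴴ) := hρ.mul_mul_conjTranspose (hV i).1
  rw [hΨV]
  refine ⟨posSemidef_sum _ fun i _ => (hVρ i).1.smul (Complex.zero_le_real.mpr (hp i)), ?_⟩
  simp only [trace_sum, trace_smul, (hVρ _).2, smul_eq_mul, mul_one, ← Complex.ofReal_sum, hp1,
    Complex.ofReal_one]

omit [DecidableEq n] in
theorem minOutputEntropy_le {b : ℝ} (hb : 1 < b) {Ψ : Matrix n n ℂ → Matrix m m ℂ}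
    (hΨ : ∀ σ, IsDensity σ → IsDensity (Ψ σ)) (hρ : IsDensity ρ) :
    minOutputEntropy b Ψ ≤ entropy b (Ψ ρ) :=
  csInf_le ⟨0, fun _ ⟨σ, hσ, h⟩ => h ▸ (hΨ σ hσ).entropy_nonneg hb⟩ ⟨ρ, hρ, rfl⟩

omit [DecidableEq n] in
theorem le_minOutputEntropy [Nonempty n] {b c : ℝ} {Ψ : Matrix n n ℂ → Matrix m m ℂ}
    (h : ∀ σ, IsDensity σ → c ≤ entropy b (Ψ σ)) : c ≤ minOutputEntropy b Ψ := by
  classical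
  exact le_csInf ⟨_, maxMixed n, isDensity_maxMixed, rfl⟩ fun _ ⟨σ, hσ, hs⟩ => hs ▸ h σ hσ

end DensityOperators

section Stinespring

variable {A B H I J K : Type*} [Fintype I]

theorem exists_isUnitaryMap_submatrix_eq [Fintype J] [DecidableEq H] [DecidableEq I]
    [DecidableEq J] {V : Matrix J H ℂ} (hV : Vᴴ * V = 1) {f : H → I} (hf : f.Injective)
    (hcard : Fintype.card J = Fintype.card I) :
    ∃ U : Matrix J I ℂ, IsUnitaryMap U ∧ U.submatrix id f = V := by
  let v : I → EuclideanSpace ℂ J :=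
    Function.extend f (fun h => WithLp.toLp 2 fun x => V x h) 0
  have hv (h : H) : v (f h) = WithLp.toLp 2 fun x => V x h := hf.extend_apply ..
  have horth : Orthonormal ℂ ((Set.range f).domRestrict v) := by
    rw [orthonormal_iff_ite]
    rintro ⟨_, h, rfl⟩ ⟨_, h', rfl⟩
    have hif : (if (⟨f h, h, rfl⟩ : Set.range f) = ⟨f h', h', rfl⟩ then (1 : ℂ) else 0) =
        (Vᴴ * V) h h' := by
      rw [hV, one_apply]
      exact if_congr (Subtype.mk_eq_mk.trans hf.eq_iff) rfl rfl
    rw [hif, Set.domRestrict_apply, Set.domRestrict_apply, hv, hv, mul_apply, PiLp.inner_apply]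
    exact Finset.sum_congr rfl fun x _ => mul_comm _ _
  obtain ⟨u, hu⟩ := horth.exists_orthonormalBasis_extension_of_card_eq (by
    rw [finrank_euclideanSpace, hcard])
  let U : Matrix J I ℂ := of fun x i => u i x
  have hU : Uᴴ * U = 1 := by
    ext i j
    rw [one_apply, ← orthonormal_iff_ite.mp u.orthonormal i j, mul_apply, PiLp.inner_apply]
    exact Finset.sum_congr rfl fun x _ => mul_comm _ _
  refine ⟨U, ⟨hU, (mul_eq_one_comm_of_card_eq _ _ _ hcard).mpr hU⟩, ?_⟩
  ext x h
  simp only [U, submatrix_apply, of_apply, id_eq, hu _ ⟨h, rfl⟩, hv]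

variable [Fintype B] [Fintype H]

/-- The completely positive map `X ↦ tr_B V X V*` with Stinespring operator `V`. It is trace
preserving if `V` is an isometry. -/
def stinespringMap (V : Matrix (K × B) I ℂ) : Matrix I I ℂ →ₗ[ℂ] Matrix K K ℂ where
  toFun X := partialTrace (V * X * Vᴴ)
  map_add' X Y := by
    rw [Matrix.mul_add, Matrix.add_mul]
    ext i j
    exact Finset.sum_add_distrib
  map_smul' c X := by
    rw [Matrix.mul_smul, Matrix.smul_mul]
    ext i j
    exact (Finset.mul_sum ..).symm

theorem stinespringMap_apply (V : Matrix (K × B) I ℂ) (X : Matrix I I ℂ) :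
    stinespringMap V X = partialTrace (V * X * Vᴴ) :=
  rfl

theorem stinespringMap_ketbra_kronecker [Fintype A] [DecidableEq A] (a₀ : A)
    (V : Matrix (K × B) (A × H) ℂ) (X : Matrix H H ℂ) :
    stinespringMap V (ketbra a₀ ⊗ₖ X) = stinespringMap (V.submatrix id (Prod.mk a₀)) X := by
  rw [stinespringMap_apply, stinespringMap_apply]
  congr 1
  ext x y
  simp [mul_apply, ketbra, Fintype.sum_prod_type, single_apply, ite_and, Finset.sum_mul]

theorem posSemidef_stinespringMap [Finite K] (V : Matrix (K × B) I ℂ) {X : Matrix I I ℂ}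
    (hX : X.PosSemidef) : (stinespringMap V X).PosSemidef :=
  posSemidef_partialTrace (hX.mul_mul_conjTranspose_same V)

variable [Fintype K]

theorem trace_stinespringMap (V : Matrix (K × B) I ℂ) (X : Matrix I I ℂ) :
    (stinespringMap V X).trace = (Vᴴ * V * X).trace := by
  rw [stinespringMap_apply, trace_partialTrace, trace_mul_cycle]

theorem IsDensity.stinespringMap [DecidableEq I] {ρ : Matrix I I ℂ} (hρ : IsDensity ρ)
    {V : Matrix (K × B) I ℂ} (hV : Vᴴ * V = 1) : IsDensity (stinespringMap V ρ) :=
  ⟨posSemidef_stinespringMap V hρ.1, by rw [trace_stinespringMap, hV, one_mul, hρ.2]⟩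

open scoped MatrixOrder Matrix.Norms.L2Operator in
theorem exists_eq_conjTranspose_mul_self {n : Type*} [Fintype n] {P : Matrix n n ℂ}
    (hP : P.PosSemidef) : ∃ L : Matrix (Fin (Fintype.card n)) n ℂ, P = Lᴴ * L := by
  classical
  obtain ⟨L, rfl⟩ := CStarAlgebra.nonneg_iff_eq_star_mul_self.mp hP.nonneg
  let e := Fintype.equivFin n
  exact ⟨L.submatrix e.symm id, by
    rw [conjTranspose_submatrix, submatrix_mul_equiv, submatrix_id_id, star_eq_conjTranspose]⟩

variable [DecidableEq H]

/-- The Choi matrix of a linear map on operators: the block matrix `∑ |h⟩⟨h'| ⊗ Φ(|h⟩⟨h'|)`. -/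
def choiMatrix (Φ : Matrix H H ℂ →ₗ[ℂ] Matrix K K ℂ) : Matrix (H × K) (H × K) ℂ :=
  of fun x y => Φ (single x.1 y.1 1) x.2 y.2

-- `choiMatrix Φ` is the image under `id ⊗ Φ` of the unnormalized maximally entangled state.
theorem IsChannel.posSemidef_choiMatrix {Φ : Matrix H H ℂ →ₗ[ℂ] Matrix K K ℂ} (hΦ : IsChannel Φ) :
    (choiMatrix Φ).PosSemidef := by
  let e := Fintype.equivFin H
  let v : Fin (Fintype.card H) × H → ℂ := fun x => if x.1 = e x.2 then 1 else 0
  convert (hΦ.completelyPositive _ _ (posSemidef_vecMulVec_self_star v)).submatrix (Prod.map e id)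
    using 1
  ext ⟨h, k⟩ ⟨h', k'⟩
  have hv : (of fun x y => vecMulVec v (star v) (e h, x) (e h', y)) = single h h' 1 := by
    ext x y
    simp [vecMulVec_apply, v, single_apply, ← ite_and, and_comm]
  simp only [choiMatrix, ampliation, submatrix_apply, of_apply, Prod.map_apply, id_eq, hv]

theorem exists_eq_stinespringMap {Φ : Matrix H H ℂ →ₗ[ℂ] Matrix K K ℂ}
    (hΦ : (choiMatrix Φ).PosSemidef) :
    ∃ V : Matrix (K × Fin (Fintype.card (H × K))) H ℂ, Φ = stinespringMap V := by
  obtain ⟨L, hL⟩ := exists_eq_conjTranspose_mul_self hΦ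
  refine ⟨of fun x h => star (L x.2 (h, x.1)), Matrix.ext_linearMap _ fun h h' => ?_⟩
  ext k k'
  simpa [choiMatrix, stinespringMap, partialTrace, mul_apply, single_apply, ite_and]
    using congrFun₂ hL (h, k) (h', k')

theorem conjTranspose_mul_self_of_trace_stinespringMap {V : Matrix (K × B) H ℂ}
    (hV : ∀ X, (stinespringMap V X).trace = X.trace) : Vᴴ * V = 1 :=
  Matrix.ext_iff_trace_mul_right.mpr fun X => by rw [← trace_stinespringMap, hV, one_mul]

theorem IsChannel.exists_stinespringDilation [DecidableEq K] [Nonempty H]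
    {Φ : Matrix H H ℂ →ₗ[ℂ] Matrix K K ℂ} (hΦ : IsChannel Φ) :
    ∃ (m n : ℕ) (a₀ : Fin m) (U : Matrix (K × Fin n) (Fin m × H) ℂ),
      IsStinespringDilation Φ a₀ U := by
  obtain ⟨V, rfl⟩ := exists_eq_stinespringMap hΦ.posSemidef_choiMatrix
  have hV := conjTranspose_mul_self_of_trace_stinespringMap hΦ.tracePreserving
  have hK : Nonempty K := (isDensity_maxMixed.stinespringMap hV).nonempty
  let a₀ : Fin (Fintype.card (K × K)) := ⟨0, Fintype.card_pos⟩
  obtain ⟨U, hU, hUV⟩ := exists_isUnitaryMap_submatrix_eq (I := Fin (Fintype.card (K × K)) × H)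
    hV (Prod.mk_right_injective a₀) (by simp only [Fintype.card_prod, Fintype.card_fin]; ring)
  refine ⟨_, _, a₀, U, hU, fun X => ?_⟩
  rw [← stinespringMap_apply, stinespringMap_ketbra_kronecker, hUV]

end Stinespring

section MixDecomposition

variable {A H : Type*} [Fintype A] [Fintype H] [DecidableEq A] [DecidableEq H]

theorem projZero_mul_mul_projZero (a₀ : A) (X : Matrix (A × H) (A × H) ℂ) :
    projZero a₀ * X * projZero a₀ = ketbra a₀ ⊗ₖ X.submatrix (Prod.mk a₀) (Prod.mk a₀) := by
  ext ⟨a, h⟩ ⟨a', h'⟩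
  rw [projZero_eq_diagonal, mul_diagonal, diagonal_mul, kronecker_apply, ketbra, single_apply]
  by_cases ha : a = a₀ <;> by_cases ha' : a' = a₀ <;> simp [ha, ha', eq_comm (a := a₀)]

theorem mix_ketbra_kronecker (a₀ : A) (X : Matrix H H ℂ) :
    mix a₀ (ketbra a₀ ⊗ₖ X) = ketbra a₀ ⊗ₖ X := by
  have hperp : projPerp a₀ * (ketbra a₀ ⊗ₖ X) = 0 := by
    rw [projPerp, ← mul_kronecker_mul, sub_mul, one_mul, ketbra, single_mul_single_same, mul_one,
      sub_self, zero_kronecker]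
  rw [mix, projZero_mul_mul_projZero, hperp, zero_mul, trace_zero, zero_smul, add_zero]
  congr 1
  ext h h'
  rw [submatrix_apply, kronecker_apply, ketbra, single_apply_same, one_mul]

theorem perpMixed_of_subsingleton [Subsingleton A] (a₀ : A) :
    (perpMixed a₀ : Matrix (A × H) (A × H) ℂ) = 0 := by
  have : Unique A := uniqueOfSubsingleton a₀
  simp [perpMixed]

omit [Fintype A] in
theorem posSemidef_one_sub_ketbra (a₀ : A) : (1 - ketbra a₀).PosSemidef := by
  rw [ketbra, ← diagonal_one, ← diagonal_single, diagonal_sub]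
  refine PosSemidef.diagonal fun a => ?_
  rw [Pi.single_apply]
  split_ifs <;> simp

theorem smul_maxMixed_sub_perpMixed (a₀ : A) :
    ((Fintype.card A : ℝ) / (Fintype.card A - 1)) • maxMixed (A × H) - perpMixed a₀ =
      (Fintype.card A - 1 : ℝ)⁻¹ • (ketbra a₀ ⊗ₖ maxMixed H) := by
  have hcard : (Fintype.card A : ℝ) ≠ 0 := Nat.cast_ne_zero.mpr (Fintype.card_pos_iff.mpr ⟨a₀⟩).ne'
  have hmixed : maxMixed (A × H) = (Fintype.card A : ℝ)⁻¹ • (1 ⊗ₖ maxMixed H) := by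
    rw [maxMixed_eq_inv_smul_one, maxMixed_eq_inv_smul_one, kronecker_smul, one_kronecker_one,
      smul_smul, Fintype.card_prod, Nat.cast_mul, mul_inv]
  have hperp : perpMixed a₀ = (Fintype.card A - 1 : ℝ)⁻¹ • ((1 - ketbra a₀) ⊗ₖ maxMixed H) := by
    rw [perpMixed, smul_kronecker, ← Complex.coe_smul]
    push_cast
    rfl
  have hsplit : (1 : Matrix A A ℂ) ⊗ₖ maxMixed H =
      ketbra a₀ ⊗ₖ maxMixed H + (1 - ketbra a₀) ⊗ₖ maxMixed H := by
    rw [← add_kronecker, add_sub_cancel]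
  rw [hmixed, hperp, smul_smul, div_mul_eq_mul_div, mul_inv_cancel₀ hcard, one_div, ← smul_sub,
    hsplit, add_sub_cancel_right]

variable [Nonempty H]

theorem isDensity_perpMixed [Nontrivial A] (a₀ : A) :
    IsDensity (perpMixed a₀ : Matrix (A × H) (A × H) ℂ) := by
  have hcard : (1 : ℂ) < Fintype.card A := by exact_mod_cast Fintype.one_lt_card (α := A)
  refine IsDensity.kronecker ⟨(posSemidef_one_sub_ketbra a₀).smul ?_, ?_⟩ isDensity_maxMixed
  · exact inv_nonneg.mpr (sub_nonneg.mpr hcard.le)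
  · rw [trace_smul, trace_sub, trace_one, (isDensity_ketbra a₀).2, smul_eq_mul,
      inv_mul_cancel₀ (sub_pos.mpr hcard).ne']

theorem posSemidef_smul_maxMixed_sub_perpMixed [Nontrivial A] (a₀ : A) :
    (((Fintype.card A : ℝ) / (Fintype.card A - 1)) • maxMixed (A × H) -
      perpMixed a₀).PosSemidef := by
  have hcard : (1 : ℝ) < Fintype.card A := by exact_mod_cast Fintype.one_lt_card (α := A)
  rw [smul_maxMixed_sub_perpMixed]
  exact ((isDensity_ketbra a₀).kronecker isDensity_maxMixed).1.smul
    (inv_nonneg.mpr (sub_nonneg.mpr hcard.le))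

theorem exists_mix_eq (a₀ : A) {X : Matrix (A × H) (A × H) ℂ} (hX : X.PosSemidef) :
    ∃ ρ : Matrix H H ℂ, IsDensity ρ ∧ ∃ p q : ℝ, 0 ≤ p ∧ 0 ≤ q ∧
      mix a₀ X = p • (ketbra a₀ ⊗ₖ ρ) + q • perpMixed a₀ := by
  obtain ⟨ρ, hρ, p, hp, hblock⟩ :=
    exists_isDensity_eq_smul (hX.submatrix (Prod.mk a₀ : H → A × H))
  have hperp : (projPerp a₀ : Matrix (A × H) (A × H) ℂ)ᴴ = projPerp a₀ :=
    ((posSemidef_one_sub_ketbra a₀).kronecker PosSemidef.one).isHermitian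
  obtain ⟨q, hq, htrace⟩ := RCLike.nonneg_iff_exists_ofReal.mp
    (hperp ▸ hX.mul_mul_conjTranspose_same (projPerp a₀)).trace_nonneg
  refine ⟨ρ, hρ, p, q, hp, hq, ?_⟩
  rw [mix, ← perpMixed, projZero_mul_mul_projZero, hblock, ← htrace, kronecker_smul,
    RCLike.ofReal_eq_complex_ofReal, Complex.coe_smul]

end MixDecomposition

section OutputEntropy

variable {A B H I K : Type*} [Fintype B] [Fintype I] [Fintype K] [DecidableEq B] [DecidableEq I]
  [DecidableEq K]

theorem IsUnitaryMap.stinespringMap_maxMixed [Nonempty I] {U : Matrix (K × B) I ℂ}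
    (hU : IsUnitaryMap U) : stinespringMap U (maxMixed I) = maxMixed K := by
  have hpartial : partialTrace (1 : Matrix (K × B) (K × B) ℂ) = (Fintype.card B : ℂ) • 1 := by
    ext k l
    simp [partialTrace, one_apply]
  have hout : stinespringMap U (maxMixed I) =
      ((Fintype.card I : ℂ)⁻¹ * Fintype.card B) • (1 : Matrix K K ℂ) := by
    rw [maxMixed, map_smul, stinespringMap_apply, Matrix.mul_one, hU.2, hpartial, smul_smul]
  have htrace := (isDensity_maxMixed.stinespringMap hU.1).2
  rw [hout, trace_smul, trace_one, smul_eq_mul] at htrace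
  rw [hout, eq_inv_of_mul_eq_one_left htrace, maxMixed]

theorem IsUnitaryMap.le_entropy_stinespringMap {b c : ℝ} (hb : 1 < b) {U : Matrix (K × B) I ℂ}
    (hU : IsUnitaryMap U) {σ : Matrix I I ℂ} (hσ : IsDensity σ)
    (hc : (c • maxMixed I - σ).PosSemidef) :
    Real.logb b (Fintype.card K) - Real.logb b c ≤ entropy b (stinespringMap U σ) := by
  have hI : Nonempty I := hσ.nonempty
  have hout : IsDensity (stinespringMap U σ) := hσ.stinespringMap hU.1
  have hK : Nonempty K := hout.nonempty
  have hcard : (0 : ℝ) < Fintype.card K := Nat.cast_pos.mpr Fintype.card_pos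
  have hcpos : 0 < c := by
    have htrace := hc.trace_nonneg
    rw [trace_sub, trace_smul, isDensity_maxMixed.2, hσ.2, Complex.real_smul, mul_one] at htrace
    have : (1 : ℝ) ≤ c := by exact_mod_cast sub_nonneg.mp htrace
    linarith
  have hbound : ((c / Fintype.card K) • 1 - stinespringMap U σ).PosSemidef := by
    have h := posSemidef_stinespringMap U hc
    rwa [map_sub, LinearMap.map_smul_of_tower, hU.stinespringMap_maxMixed,
      maxMixed_eq_inv_smul_one, smul_smul, ← div_eq_mul_inv] at h
  have h := hout.neg_logb_le_entropy hb hbound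
  rwa [Real.logb_div hcpos.ne' hcard.ne', neg_sub] at h

variable [Fintype A] [Fintype H] [DecidableEq A] [DecidableEq H] {a₀ : A}
  {U : Matrix (K × B) (A × H) ℂ}

theorem IsUnitaryMap.entropy_ruApprox (b : ℝ) (hU : IsUnitaryMap U)
    {X : Matrix (A × H) (A × H) ℂ} (hX : IsDensity X) :
    entropy b (ruApprox a₀ U X) =
      entropy b (stinespringMap U (mix a₀ X)) + Real.logb b (Fintype.card B) := by
  have hmix : IsDensity (mix a₀ X) := (isRandomUnitary_mix a₀).isDensity_apply hX
  obtain ⟨_, b₀⟩ := (hmix.mul_mul_conjTranspose hU.1).nonempty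
  have : Nonempty B := ⟨b₀⟩
  rw [ruApprox_eq_mixOut_mix, ← (hmix.stinespringMap hU.1).entropy_kronecker_maxMixed]
  rfl

variable {Φ : Matrix H H ℂ → Matrix K K ℂ} {b : ℝ}

theorem IsStinespringDilation.apply_eq_stinespringMap (hU : IsStinespringDilation Φ a₀ U)
    (X : Matrix H H ℂ) : Φ X = stinespringMap U (ketbra a₀ ⊗ₖ X) :=
  hU.2 X

theorem IsStinespringDilation.isDensity_apply (hU : IsStinespringDilation Φ a₀ U)
    {ρ : Matrix H H ℂ} (hρ : IsDensity ρ) : IsDensity (Φ ρ) :=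
  hU.apply_eq_stinespringMap ρ ▸ ((isDensity_ketbra a₀).kronecker hρ).stinespringMap hU.1.1

theorem IsStinespringDilation.minOutputEntropy_ruApprox_sub_logb_le [Nonempty H] (hb : 1 < b)
    (hU : IsStinespringDilation Φ a₀ U) :
    minOutputEntropy b (ruApprox a₀ U) - Real.logb b (Fintype.card B) ≤ minOutputEntropy b Φ := by
  refine le_minOutputEntropy fun ρ hρ => sub_le_iff_le_add.mpr ?_
  have hX : IsDensity (ketbra a₀ ⊗ₖ ρ) := (isDensity_ketbra a₀).kronecker hρ
  calc minOutputEntropy b (ruApprox a₀ U)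
      ≤ entropy b (ruApprox a₀ U (ketbra a₀ ⊗ₖ ρ)) :=
        minOutputEntropy_le hb (fun _ => (isRandomUnitary_ruApprox a₀ hU.1).isDensity_apply) hX
    _ = entropy b (Φ ρ) + Real.logb b (Fintype.card B) := by
        rw [hU.1.entropy_ruApprox b hX, mix_ketbra_kronecker, hU.apply_eq_stinespringMap]

theorem IsStinespringDilation.minOutputEntropy_le_logb_card [Nonempty H] (hb : 1 < b)
    (hU : IsStinespringDilation Φ a₀ U) :
    minOutputEntropy b Φ ≤ Real.logb b (Fintype.card K) :=
  (minOutputEntropy_le hb (fun _ => hU.isDensity_apply) isDensity_maxMixed).trans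
    ((hU.isDensity_apply isDensity_maxMixed).entropy_le_logb_card hb)

theorem IsStinespringDilation.le_entropy_stinespringMap_perpMixed [Nonempty H] [Nontrivial A]
    (hb : 1 < b) (hU : IsStinespringDilation Φ a₀ U) :
    minOutputEntropy b Φ - Real.logb b (Fintype.card A / (Fintype.card A - 1)) ≤
      entropy b (stinespringMap U (perpMixed a₀)) :=
  (sub_le_sub_right (hU.minOutputEntropy_le_logb_card hb) _).trans
    (hU.1.le_entropy_stinespringMap hb (isDensity_perpMixed a₀)
      (posSemidef_smul_maxMixed_sub_perpMixed a₀))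

theorem IsStinespringDilation.minOutputEntropy_le_ruApprox_of_subsingleton [Nonempty H]
    [Subsingleton A] (hb : 1 < b) (hU : IsStinespringDilation Φ a₀ U) :
    minOutputEntropy b Φ ≤
      minOutputEntropy b (ruApprox a₀ U) - Real.logb b (Fintype.card B) := by
  have : Nonempty A := ⟨a₀⟩
  refine le_sub_iff_add_le.mpr (le_minOutputEntropy fun X hX => ?_)
  obtain ⟨ρ, hρ, p, q, -, -, hmix⟩ := exists_mix_eq a₀ hX.1
  rw [perpMixed_of_subsingleton, smul_zero, add_zero] at hmix
  have htrace := ((isRandomUnitary_mix a₀).isDensity_apply hX).2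
  rw [hmix, trace_smul, ((isDensity_ketbra a₀).kronecker hρ).2, Complex.real_smul, mul_one,
    Complex.ofReal_eq_one] at htrace
  rw [hU.1.entropy_ruApprox b hX, hmix, htrace, one_smul, ← hU.apply_eq_stinespringMap]
  exact add_le_add_left (minOutputEntropy_le hb (fun _ => hU.isDensity_apply) hρ) _

-- The entropies of both terms of `mix a₀ X` are bounded below, and the superlevel sets of the
-- entropy are convex.
theorem IsStinespringDilation.minOutputEntropy_sub_logb_le_ruApprox [Nonempty H] [Nontrivial A]
    (hb : 1 < b) (hU : IsStinespringDilation Φ a₀ U) :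
    minOutputEntropy b Φ - Real.logb b (Fintype.card A / (Fintype.card A - 1)) ≤
      minOutputEntropy b (ruApprox a₀ U) - Real.logb b (Fintype.card B) := by
  have hcard : (1 : ℝ) < Fintype.card A := by exact_mod_cast Fintype.one_lt_card (α := A)
  have hlog : 0 ≤ Real.logb b (Fintype.card A / (Fintype.card A - 1)) :=
    Real.logb_nonneg hb ((one_le_div (by linarith)).mpr (by linarith))
  refine le_sub_iff_add_le.mpr (le_minOutputEntropy fun X hX => ?_)
  rw [hU.1.entropy_ruApprox b hX]
  refine add_le_add_left ?_ _
  obtain ⟨ρ, hρ, p, q, hp, hq, hmix⟩ := exists_mix_eq a₀ hX.1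
  have htrace := ((isRandomUnitary_mix a₀).isDensity_apply hX).2
  rw [hmix, trace_add, trace_smul, trace_smul, ((isDensity_ketbra a₀).kronecker hρ).2,
    (isDensity_perpMixed a₀).2, ← add_smul, Complex.real_smul, mul_one,
    Complex.ofReal_eq_one] at htrace
  have hΦρ : minOutputEntropy b Φ ≤ entropy b (Φ ρ) :=
    minOutputEntropy_le hb (fun _ => hU.isDensity_apply) hρ
  rw [hmix, map_add, LinearMap.map_smul_of_tower, LinearMap.map_smul_of_tower,
    ← hU.apply_eq_stinespringMap]
  exact ((concaveOn_entropy hb).convex_ge _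
    ⟨(hU.isDensity_apply hρ).1, (sub_le_self _ hlog).trans hΦρ⟩
    ⟨((isDensity_perpMixed a₀).stinespringMap hU.1.1).1,
      hU.le_entropy_stinespringMap_perpMixed hb⟩ hp hq htrace).2

theorem logb_div_sub_one_le {b d : ℝ} (hb : 1 < b) (hd : 2 ≤ d) :
    Real.logb b (d / (d - 1)) ≤ 8 * Real.logb b d / d := by
  have hlog_two : 1 / 2 ≤ Real.log d := by
    linarith [Real.log_two_gt_d9, Real.log_le_log two_pos hd]
  have hlog : Real.log (d / (d - 1)) ≤ 8 * Real.log d / d :=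
    calc Real.log (d / (d - 1)) ≤ d / (d - 1) - 1 :=
          Real.log_le_sub_one_of_pos (div_pos (by linarith) (by linarith))
      _ = 1 / (d - 1) := by rw [div_sub_one (by linarith), sub_sub_cancel]
      _ ≤ 2 / d := by
          rw [div_le_div_iff₀ (by linarith) (by linarith)]
          linarith
      _ ≤ 8 * Real.log d / d := div_le_div_of_nonneg_right (by linarith) (by linarith)
  rw [Real.logb, Real.logb, ← mul_div_assoc, div_right_comm]
  exact div_le_div_of_nonneg_right hlog (Real.log_pos hb).le

theorem IsStinespringDilation.minOutputEntropy_sub_le_ruApprox [Nonempty H] (hb : 1 < b)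
    (hU : IsStinespringDilation Φ a₀ U) :
    minOutputEntropy b Φ - 8 * Real.logb b (Fintype.card A) / Fintype.card A ≤
      minOutputEntropy b (ruApprox a₀ U) - Real.logb b (Fintype.card B) := by
  rcases subsingleton_or_nontrivial A with hA | hA
  · have : Unique A := uniqueOfSubsingleton a₀
    simpa using hU.minOutputEntropy_le_ruApprox_of_subsingleton hb
  · have hcard : (2 : ℝ) ≤ Fintype.card A := by exact_mod_cast Fintype.one_lt_card (α := A)
    exact (sub_le_sub_left (logb_div_sub_one_le hb hcard) _).trans
      (hU.minOutputEntropy_sub_logb_le_ruApprox hb)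

end OutputEntropy

end QChan

theorem mainTheorem3 {H K : Type*} [Fintype H] [Fintype K] [DecidableEq H] [DecidableEq K]
    [Nonempty H] (b : ℝ) (hb : 1 < b)
    (Φ : Matrix H H ℂ →ₗ[ℂ] Matrix K K ℂ) (hΦ : QChan.IsChannel Φ) :
    (∃ (m n : ℕ) (a₀ : Fin m) (U : Matrix (K × Fin n) (Fin m × H) ℂ),
      QChan.IsStinespringDilation Φ a₀ U) ∧
    ∀ (A B : Type*) [Fintype A] [Fintype B] [DecidableEq A] [DecidableEq B]
      (a₀ : A) (U : Matrix (K × B) (A × H) ℂ), QChan.IsStinespringDilation Φ a₀ U →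
      QChan.IsRandomUnitary (QChan.ruApprox a₀ U) ∧
      QChan.minOutputEntropy b Φ ≥
        QChan.minOutputEntropy b (QChan.ruApprox a₀ U) - Real.logb b (Fintype.card B) ∧
      QChan.minOutputEntropy b (QChan.ruApprox a₀ U) - Real.logb b (Fintype.card B) ≥
        QChan.minOutputEntropy b Φ -
          8 * Real.logb b (Fintype.card A) / (Fintype.card A : ℝ) := by
  refine ⟨hΦ.exists_stinespringDilation, fun A B _ _ _ _ a₀ U hU => ⟨?_, ?_, ?_⟩⟩
  · exact QChan.isRandomUnitary_ruApprox a₀ hU.1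
  · exact hU.minOutputEntropy_ruApprox_sub_logb_le hb
  · exact hU.minOutputEntropy_sub_le_ruApprox hb
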